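/- Notation. $\mathbb N$ denotes the set of strictly positive integers. Let $P=\sum_\alpha c_\alpha x^\alpha\in\mathbb Z[x_1,\dots,x_n]$, let $\mathrm{Supp}(P)=\{\alpha\in\mathbb Z_{\ge 0}^n: c_\alpha\neq 0\}$ and $|\alpha|=\alpha_1+\dots+\alpha_n$. Put $\tilde P(w)=P(w,\dots,w)$ and $P^{(a)}(x_1,\dots,x_n)=P(x_1+a,\dots,x_n+a)$ for $a\in\mathbb Z$. The polynomial $P$ is *partition regular* if for every finite coloring of $\mathbb N$ there are infinitely many monochromatic sets of the form $\{a_1,\dots,a_n\}\subseteq\mathbb N$ with $P(a_1,\dots,a_n)=0$. For $t=(t_1,\dots,t_n)\in\mathbb N^n$ let $\phi_t(\alpha)=t_1\alpha_1+\dots+t_n\alpha_n$; for a finite coloring $c$ of $\mathbb N$, $\phi_t$ is $c$-monochromatic if $\{t_1,\dots,t_n\}$ is. If $M_0<\dots<M_\ell$ are the elements of $\phi_t(\mathrm{Supp}(P))$, the partition of $\mathrm{Supp}(P)$ determined by $\phi_t$ is $(J_0,\dots,J_\ell)$ with $J_i=\{\alpha\in\mathrm{Supp}(P):\phi_t(\alpha)=M_i\}$.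 A *lower Rado functional* of order $m\ge 0$ for $P$ is a tuple $(J_0,\dots,J_\ell,d_1,\dots,d_m)$ with $\ell\ge m$ and $d_1,\dots,d_m\in\mathbb N$ such that, for every finite coloring $c$ of $\mathbb N$ and every $N\in\mathbb N$, there are infinitely many $c$-monochromatic $\phi_t$ such that $(J_0,\dots,J_\ell)$ is the partition of $\mathrm{Supp}(P)$ determined by $\phi_t$ and, if $M_0<\dots<M_\ell$ are the elements of $\phi_t(\mathrm{Supp}(P))$, then $M_i-M_0=d_i$ for $1\le i\le m$ and, if $m<\ell$, $M_{m+1}-M_m\ge N$. An *upper Rado functional* of order $m\ge 0$ for $P$ is a tuple $(J_0,\dots,J_\ell,d_0,\dots,d_{m-1})$ with $\ell\ge m$ and $d_0,\dots,d_{m-1}\in\mathbb N$ such that, for every finite coloring $c$ of $\mathbb N$ and every $N\in\mathbb N$, there are infinitely many $c$-monochromatic $\phi_t$ such that $(J_\ell,\dots,J_0)$ is the partition of $\mathrm{Supp}(P)$ determined by $\phi_t$ and, if $M_\ell<\dots<M_0$ are the elements of $\phi_t(\mathrm{Supp}(P))$, then $M_i-M_m=d_i$ for $0\le i\le m-1$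 and, if $m<\ell$, $M_m-M_{m+1}\ge N$. Theorem. Suppose that $P\in\mathbb Z[x_1,\dots,x_n]$ is partition regular. 1. If $P\neq 0$, then $P$ satisfies the *maximal Rado condition*: for every integer $q\ge 2$ there is an upper Rado functional $(J_0,\dots,J_\ell,d_0,\dots,d_{m-1})$ for $P$ such that, setting $d_m:=0$, the polynomial $$w\mapsto\sum_{i=0}^m q^{d_i}\sum_{\alpha\in J_i}c_\alpha w^{|\alpha|}$$ has a real root in $[1,q]$. 2. If $\tilde P$ is nonzero and splits over $\mathbb Z$ as a product of linear factors, that is, $\tilde P(w)=b\,(w-a_1)\cdots(w-a_k)$ with $b,a_1,\dots,a_k\in\mathbb Z$ and $k\ge 0$, then $P$ satisfies the *minimal Rado condition*: for every prime $p$ there are a root $a\in\mathbb Z$ of $\tilde P$ and a lower Rado functional $(J_0,\dots,J_\ell,d_1,\dots,d_m)$ for $P^{(a)}$ such that, setting $d_0:=0$, the equation $$\sum_{i=0}^m p^{d_i}\sum_{\alpha\in J_i}\frac1{\alpha!}\frac{\partial^\alpha P}{\partial x^\alpha}(a,\dots,a)\,w^{|\alpha|}=0$$ has an invertible solution $w$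 in the ring $\mathbb Z_p$ of $p$-adic integers. -/

import Mathlib

namespace Rado

/-! Throughout, `ℕ+` is the set of strictly positive integers, and a multi-index in `n` variables is
an element of `Fin n →₀ ℕ`. -/

/-- `A` is monochromatic for the coloring `c` with `k` colors. -/
def Monochromatic {k : ℕ} (c : ℕ+ → Fin k) (A : Set ℕ+) : Prop :=
  ∃ i, ∀ a ∈ A, c a = i

/-- A family of sets of positive integers is partition regular if every finite coloring of the
positive integers admits infinitely many monochromatic members of the family. -/
def PartitionRegularFamily (𝒜 : Set (Set ℕ+)) : Prop :=
  ∀ (k : ℕ) (c : ℕ+ → Fin k), {A ∈ 𝒜 | Monochromatic c A}.Infinite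

/-- The family of all sets `{a₁, …, aₙ}` of positive integers with `P(a₁, …, aₙ) = 0`. -/
def solutionSets {n : ℕ} (P : MvPolynomial (Fin n) ℤ) : Set (Set ℕ+) :=
  {A | ∃ a : Fin n → ℕ+, A = Set.range a ∧ MvPolynomial.eval (fun i => ((a i : ℕ) : ℤ)) P = 0}

/-- The polynomial `P` (equivalently the equation `P = 0`) is partition regular. -/
def PartitionRegular {n : ℕ} (P : MvPolynomial (Fin n) ℤ) : Prop :=
  PartitionRegularFamily (solutionSets P)

/-- The one-variable polynomial `P̃(w) = P(w, …, w)`. -/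
noncomputable def diag {n : ℕ} (P : MvPolynomial (Fin n) ℤ) : Polynomial ℤ :=
  MvPolynomial.aeval (fun _ => (Polynomial.X : Polynomial ℤ)) P

/-- The translated polynomial `P^{(r)}(x₁, …, xₙ) = P(x₁ + r, …, xₙ + r)`. -/
noncomputable def translate {n : ℕ} (r : ℤ) (P : MvPolynomial (Fin n) ℤ) :
    MvPolynomial (Fin n) ℤ :=
  MvPolynomial.aeval (fun i => MvPolynomial.X i + MvPolynomial.C r) P

/-- The iterated partial derivative `∂^α P / ∂x^α`. -/
noncomputable def iteratedPderiv {n : ℕ} (α : Fin n →₀ ℕ) (P : MvPolynomial (Fin n) ℤ) :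
    MvPolynomial (Fin n) ℤ :=
  (List.finRange n).foldr (fun i Q => (MvPolynomial.pderiv i)^[α i] Q) P

/-- The Taylor coefficient `(1 / α!) (∂^α P / ∂x^α)(a, …, a)`. The division of integers is exact,
see `taylorCoeff_mul_factorial` below. -/
noncomputable def taylorCoeff {n : ℕ} (P : MvPolynomial (Fin n) ℤ) (a : ℤ) (α : Fin n →₀ ℕ) : ℤ :=
  MvPolynomial.eval (fun _ => a) (iteratedPderiv α P) / ((∏ i, (α i).factorial : ℕ) : ℤ)

/-- The value `φ(α) = t₁ α₁ + ⋯ + tₙ αₙ` at a multi-index `α` of the positive linear map `φ` with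
coefficients `t₁, …, tₙ`. Distinct tuples `t` give distinct maps. The coefficients are
taken in `ℕ+` because they are required to be monochromatic for colorings of `ℕ+`. -/
def weight {n : ℕ} (t : Fin n → ℕ+) (α : Fin n →₀ ℕ) : ℕ :=
  ∑ i, (t i : ℕ) * α i

/-- `M = (M₀, …, M_ℓ)` is the increasing enumeration of `φ(Supp P)` and `J = (J₀, …, J_ℓ)` is the
partition of `Supp P` determined by `φ`, where `φ` is the linear map with coefficients `t`. -/
def Determines {n ℓ : ℕ} (P : MvPolynomial (Fin n) ℤ) (t : Fin n → ℕ+)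
    (J : Fin (ℓ + 1) → Finset (Fin n →₀ ℕ)) (M : Fin (ℓ + 1) → ℕ) : Prop :=
  StrictMono M ∧ Set.range M = weight t '' (P.support : Set (Fin n →₀ ℕ)) ∧
    ∀ i, J i = P.support.filter (fun α => weight t α = M i)

/-- `(J₀, …, J_ℓ, d₁, …, d_m)` is a lower Rado functional of order `m` for `P`; here `d j` stands
for `d_{j+1}`. The last requirement, `M_{m+1} - M_m ≥ N`, is void when `m = ℓ`. -/
def IsLowerRadoFunctional {n : ℕ} (P : MvPolynomial (Fin n) ℤ) (ℓ m : ℕ)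
    (J : Fin (ℓ + 1) → Finset (Fin n →₀ ℕ)) (d : Fin m → ℕ) : Prop :=
  ∃ hm : m ≤ ℓ, (∀ j, 0 < d j) ∧
    ∀ (k : ℕ) (c : ℕ+ → Fin k) (N : ℕ),
      {t : Fin n → ℕ+ | Monochromatic c (Set.range t) ∧
        ∃ M : Fin (ℓ + 1) → ℕ, Determines P t J M ∧
          (∀ j : Fin m, M ⟨j + 1, by omega⟩ = M 0 + d j) ∧
          (∀ h : m < ℓ, M ⟨m, by omega⟩ + N ≤ M ⟨m + 1, by omega⟩)}.Infinite

/-- `(J₀, …, J_ℓ, d₀, …, d_{m-1})` is an upper Rado functional of order `m` for `P`. Here the tuples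
are numbered downwards: `(M_ℓ, …, M₀)` is the increasing enumeration of `φ(Supp P)`, with
associated partition `(J_ℓ, …, J₀)`. The last requirement, `M_m - M_{m+1} ≥ N`, is void when
`m = ℓ`. -/
def IsUpperRadoFunctional {n : ℕ} (P : MvPolynomial (Fin n) ℤ) (ℓ m : ℕ)
    (J : Fin (ℓ + 1) → Finset (Fin n →₀ ℕ)) (d : Fin m → ℕ) : Prop :=
  ∃ hm : m ≤ ℓ, (∀ j, 0 < d j) ∧
    ∀ (k : ℕ) (c : ℕ+ → Fin k) (N : ℕ),
      {t : Fin n → ℕ+ | Monochromatic c (Set.range t) ∧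
        ∃ M : Fin (ℓ + 1) → ℕ, Determines P t (J ∘ Fin.rev) (M ∘ Fin.rev) ∧
          (∀ j : Fin m, M ⟨j, by omega⟩ = M ⟨m, by omega⟩ + d j) ∧
          (∀ h : m < ℓ, M ⟨m + 1, by omega⟩ + N ≤ M ⟨m, by omega⟩)}.Infinite

/-- The one-variable polynomial `∑_{i ≤ m} q^{e_i} ∑_{α ∈ J_i} c_α w^{|α|}`. -/
noncomputable def radoPolynomial {n m : ℕ} (c : (Fin n →₀ ℕ) → ℤ) (q : ℕ)
    (J : Fin (m + 1) → Finset (Fin n →₀ ℕ)) (e : Fin (m + 1) → ℕ) : Polynomial ℤ :=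
  ∑ i, Polynomial.C ((q : ℤ) ^ e i) *
    ∑ α ∈ J i, Polynomial.C (c α) * Polynomial.X ^ (∑ j, α j)

/-- The maximal Rado condition; `Fin.snoc d 0` is the tuple `(d₀, …, d_{m-1}, 0)`. -/
def MaximalRadoCondition {n : ℕ} (P : MvPolynomial (Fin n) ℤ) : Prop :=
  ∀ q : ℕ, 2 ≤ q → ∃ (ℓ m : ℕ) (hm : m ≤ ℓ) (J : Fin (ℓ + 1) → Finset (Fin n →₀ ℕ))
    (d : Fin m → ℕ), IsUpperRadoFunctional P ℓ m J d ∧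
      ∃ w ∈ Set.Icc (1 : ℝ) q,
        Polynomial.aeval w (radoPolynomial (fun α => P.coeff α) q
          (fun i => J (Fin.castLE (Nat.succ_le_succ hm) i))
          (Fin.snoc (α := fun _ => ℕ) d 0)) = 0

/-- The minimal Rado condition; `Fin.cons 0 d` is the tuple `(0, d₁, …, d_m)`. -/
def MinimalRadoCondition {n : ℕ} (P : MvPolynomial (Fin n) ℤ) : Prop :=
  ∀ (p : ℕ) [Fact p.Prime], ∃ a : ℤ, (diag P).IsRoot a ∧
    ∃ (ℓ m : ℕ) (hm : m ≤ ℓ) (J : Fin (ℓ + 1) → Finset (Fin n →₀ ℕ)) (d : Fin m → ℕ),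
      IsLowerRadoFunctional (translate a P) ℓ m J d ∧
      ∃ w : ℤ_[p], IsUnit w ∧
        Polynomial.aeval w (radoPolynomial (taylorCoeff P a) p
          (fun i => J (Fin.castLE (Nat.succ_le_succ hm) i))
          (Fin.cons (α := fun _ => ℕ) 0 d)) = 0

/-! The integers `taylorCoeff P a α` are the coefficients of `P^{(a)}`. -/

theorem translate_pderiv {n : ℕ} (r : ℤ) (i : Fin n) (P : MvPolynomial (Fin n) ℤ) :
    translate r (MvPolynomial.pderiv i P) = MvPolynomial.pderiv i (translate r P) := by
  unfold translate
  induction P using MvPolynomial.induction_on with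
  | C a => simp
  | add p q hp hq => simp only [map_add, hp, hq]
  | mul_X p j h =>
    simp only [Derivation.leibniz, map_add, map_mul, smul_eq_mul, MvPolynomial.aeval_X, h,
      MvPolynomial.pderiv_C, add_zero]
    by_cases hij : j = i
    · subst hij; simp
    · simp [MvPolynomial.pderiv_X_of_ne hij]

theorem translate_foldr {n : ℕ} (r : ℤ) (α : Fin n →₀ ℕ) (P : MvPolynomial (Fin n) ℤ)
    (l : List (Fin n)) :
    translate r (l.foldr (fun i Q => (MvPolynomial.pderiv i)^[α i] Q) P) =
      l.foldr (fun i Q => (MvPolynomial.pderiv i)^[α i] Q) (translate r P) := by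
  induction l with
  | nil => rfl
  | cons i l ih =>
    simp only [List.foldr_cons]
    rw [← ih]
    exact Function.Commute.iterate_right (f := translate r) (g := MvPolynomial.pderiv i)
      (fun Q => translate_pderiv r i Q) (α i) _

theorem coeff_iterate_pderiv {n : ℕ} (i : Fin n) (k : ℕ) (β : Fin n →₀ ℕ)
    (Q : MvPolynomial (Fin n) ℤ) :
    ((MvPolynomial.pderiv i)^[k] Q).coeff β =
      ((β i + 1).ascFactorial k : ℤ) * Q.coeff (β + Finsupp.single i k) := by
  induction k generalizing Q with
  | zero => simp
  | succ k ih =>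
    rw [Function.iterate_succ_apply, ih, MvPolynomial.coeff_pderiv, Nat.ascFactorial_succ,
      add_assoc, ← Finsupp.single_add]
    simp
    ring

theorem coeff_foldr {n : ℕ} (α : Fin n →₀ ℕ) (Q : MvPolynomial (Fin n) ℤ) (l : List (Fin n))
    (hl : l.Nodup) (β : Fin n →₀ ℕ) (hβ : ∀ i ∈ l, β i = 0) :
    (l.foldr (fun i Q => (MvPolynomial.pderiv i)^[α i] Q) Q).coeff β =
      ((l.map fun i => (α i).factorial).prod : ℕ) *
        Q.coeff (β + (l.map fun i => Finsupp.single i (α i)).sum) := by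
  induction l generalizing β with
  | nil => simp
  | cons i l ih =>
    rw [List.nodup_cons] at hl
    have h0 : β i = 0 := hβ i (by simp)
    rw [List.foldr_cons, coeff_iterate_pderiv, ih hl.2, h0]
    · simp [Nat.one_ascFactorial, mul_assoc, add_assoc]
    · intro j hj
      have hne : i ≠ j := fun h => hl.1 (h ▸ hj)
      simp [hβ j (by simp [hj]), hne]

theorem eval_eq_coeff_translate {n : ℕ} (a : ℤ) (P : MvPolynomial (Fin n) ℤ) :
    MvPolynomial.eval (fun _ => a) P = (translate a P).coeff 0 := by
  rw [← MvPolynomial.constantCoeff_eq]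
  unfold translate
  induction P using MvPolynomial.induction_on with
  | C a => simp
  | add p q hp hq => simp [hp, hq]
  | mul_X p j h => simp [h]

theorem eval_iteratedPderiv {n : ℕ} (P : MvPolynomial (Fin n) ℤ) (a : ℤ) (α : Fin n →₀ ℕ) :
    MvPolynomial.eval (fun _ => a) (iteratedPderiv α P) =
      ((∏ i, (α i).factorial : ℕ) : ℤ) * (translate a P).coeff α := by
  rw [eval_eq_coeff_translate, iteratedPderiv, translate_foldr,
    coeff_foldr _ _ _ (List.nodup_finRange n) _ (by simp)]
  rw [← List.ofFn_eq_map, List.prod_ofFn, ← List.ofFn_eq_map, List.sum_ofFn, zero_add,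
    Finsupp.univ_sum_single]

theorem taylorCoeff_eq {n : ℕ} (P : MvPolynomial (Fin n) ℤ) (a : ℤ) (α : Fin n →₀ ℕ) :
    taylorCoeff P a α = (translate a P).coeff α := by
  have h : ((∏ i, (α i).factorial : ℕ) : ℤ) ≠ 0 := by
    exact_mod_cast Finset.prod_ne_zero_iff.2 fun i _ => Nat.factorial_ne_zero _
  rw [taylorCoeff, eval_iteratedPderiv, Int.mul_ediv_cancel_left _ h]

theorem taylorCoeff_mul_factorial {n : ℕ} (P : MvPolynomial (Fin n) ℤ) (a : ℤ)
    (α : Fin n →₀ ℕ) :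
    ((∏ i, (α i).factorial : ℕ) : ℤ) * taylorCoeff P a α =
      MvPolynomial.eval (fun _ => a) (iteratedPderiv α P) := by
  rw [taylorCoeff_eq, eval_iteratedPderiv]

end Rado

namespace Rado

open Filter Topology

/-! ### The ultrafilter of a partition regular polynomial -/

/-! Partition regularity yields an ultrafilter `U` on tuples that concentrates on solutions and
whose coordinates all push `U` to the same nonprincipal ultrafilter `u` on `ℕ+`
(`PartitionRegular.exists_ultrafilter`).

Write each coordinate as `s ^ τ(y) * f(y)`, with `τ → ∞` along `u` and `f` valued in a compact set.
In the real case `s = q`, `τ` is the integer part of `log_q y` and `f ∈ [1, q]`. In the `p`-adic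
case `y` is replaced by `y - a`, where `a` is the limit of `y` in `ℤ_[p]`, an integer root of `diag
P` because `diag P` splits; `τ` is the valuation and `f` is a unit. Since `f (x i)` depends only on
`x i`, all these factors tend to one limit `w`. The monomial `α` carries the power `s ^ φ_t(α)` with
`t i = τ (x i)`. Dividing `P = 0` by the dominant power and passing to the limit
(`exists_dominant_blocks`) keeps exactly the blocks at bounded distance from the dominant one, and
the distances are constant along `U`. This is the required equation for `w`. The tuples `t` witness
the Rado functional: `c ∘ τ` is constant `u`-almost everywhere, so they are monochromatic, and `τ →
∞` makes them infinitely many. -/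

theorem Monochromatic.of_comp {k l : ℕ} {c : ℕ+ → Fin k} {A : Set ℕ+} (h : Monochromatic c A)
    (g : Fin k → Fin l) : Monochromatic (g ∘ c) A :=
  h.imp' g fun _ hi a ha => congrArg g (hi a ha)

theorem PartitionRegular.infinite_tuples {n : ℕ} {P : MvPolynomial (Fin n) ℤ}
    (hP : PartitionRegular P) {k : ℕ} (c : ℕ+ → Fin k) :
    {x : Fin n → ℕ+ | Monochromatic c (Set.range x) ∧
      MvPolynomial.eval (fun i => ((x i : ℕ) : ℤ)) P = 0}.Infinite := by
  intro hfin
  refine hP k c ((hfin.image Set.range).subset ?_)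
  rintro A ⟨⟨x, rfl, hx⟩, hc⟩
  exact ⟨x, ⟨hc, hx⟩, rfl⟩

theorem PartitionRegular.nonempty_index {n : ℕ} {P : MvPolynomial (Fin n) ℤ}
    (hP : PartitionRegular P) : Nonempty (Fin n) := by
  by_contra h
  rw [not_nonempty_iff] at h
  exact hP.infinite_tuples (fun _ => (0 : Fin 1)) (Set.toFinite _)

/-- Solutions monochromatic for `c` and outside a finite set `F` form a directed family of nonempty
sets, by product colorings; `U` is any ultrafilter containing them all. The coloring by `A` and its
complement forces equal images of the coordinates, and the removal of finite sets excludes a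
principal image. -/
theorem PartitionRegular.exists_ultrafilter {n : ℕ} {P : MvPolynomial (Fin n) ℤ}
    (hP : PartitionRegular P) :
    ∃ (U : Ultrafilter (Fin n → ℕ+)) (u : Ultrafilter ℕ+),
      (∀ i, Tendsto (fun x : Fin n → ℕ+ => x i) U u) ∧ (u : Filter ℕ+) ≤ cofinite ∧
      ∀ᶠ x : Fin n → ℕ+ in U, MvPolynomial.eval (fun i => ((x i : ℕ) : ℤ)) P = 0 := by
  obtain ⟨i₀⟩ := hP.nonempty_index
  let S : ((k : ℕ) × (ℕ+ → Fin k)) × Finset (Fin n → ℕ+) → Set (Fin n → ℕ+) := fun s =>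
    {x | Monochromatic s.1.2 (Set.range x) ∧
      MvPolynomial.eval (fun i => ((x i : ℕ) : ℤ)) P = 0} \ s.2
  have hdir : Directed (· ≥ ·) fun s => 𝓟 (S s) := by
    rintro ⟨⟨k, c⟩, F⟩ ⟨⟨l, c'⟩, F'⟩
    classical
    refine ⟨⟨⟨k * l, fun a => finProdFinEquiv (c a, c' a)⟩, F ∪ F'⟩, ?_, ?_⟩
    · refine principal_mono.2 ?_
      rintro x ⟨⟨hc, hx⟩, hF⟩
      refine ⟨⟨?_, hx⟩, fun h => hF (by simp_all)⟩
      simpa only [Function.comp_def, Equiv.symm_apply_apply] using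
        hc.of_comp fun z => (finProdFinEquiv.symm z).1
    · refine principal_mono.2 ?_
      rintro x ⟨⟨hc, hx⟩, hF⟩
      refine ⟨⟨?_, hx⟩, fun h => hF (by simp_all)⟩
      simpa only [Function.comp_def, Equiv.symm_apply_apply] using
        hc.of_comp fun z => (finProdFinEquiv.symm z).2
  have hne : (⨅ s, 𝓟 (S s)).NeBot := by
    have : Nonempty (((k : ℕ) × (ℕ+ → Fin k)) × Finset (Fin n → ℕ+)) :=
      ⟨⟨⟨1, fun _ => 0⟩, ∅⟩⟩
    refine iInf_neBot_of_directed hdir fun s => principal_neBot_iff.2 ?_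
    exact ((hP.infinite_tuples s.1.2).sdiff s.2.finite_toSet).nonempty
  obtain ⟨U, hU⟩ := Ultrafilter.exists_le (⨅ s, 𝓟 (S s))
  have hmem : ∀ s, S s ∈ U := fun s => hU (mem_iInf_of_mem s (mem_principal_self _))
  have htend : ∀ i, Tendsto (fun x : Fin n → ℕ+ => x i) U
      (U.map fun x : Fin n → ℕ+ => x i₀ : Ultrafilter ℕ+) := by
    intro i A hA
    classical
    have hA' : ∀ᶠ x : Fin n → ℕ+ in U, x i₀ ∈ A := hA
    change ∀ᶠ x : Fin n → ℕ+ in U, x i ∈ A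
    filter_upwards [hA', hmem ⟨⟨2, fun a => if a ∈ A then 0 else 1⟩, ∅⟩] with x hx hx'
    obtain ⟨⟨⟨j, hj⟩, -⟩, -⟩ := hx'
    have h1 := hj (x i) ⟨i, rfl⟩
    have h2 := hj (x i₀) ⟨i₀, rfl⟩
    by_contra hi
    have hi' : x i ∉ A := hi
    have hx' : x i₀ ∈ A := hx
    simp only [hi', hx', if_true, if_false] at h1 h2
    omega
  refine ⟨U, U.map fun x => x i₀, htend, ?_, ?_⟩
  · rcases (U.map fun x : Fin n → ℕ+ => x i₀).le_cofinite_or_eq_pure with h | ⟨a, ha⟩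
    · exact h
    · exfalso
      -- A principal image would concentrate `U` on one constant tuple, which is excluded by taking
      -- it as `F`.
      have h1 : ∀ᶠ x : Fin n → ℕ+ in U, ∀ i, x i = a := by
        rw [eventually_all]
        intro i
        have := htend i
        rw [ha] at this
        exact this (by simp : {a} ∈ (pure a : Filter ℕ+))
      obtain ⟨x, hx, hx'⟩ := (h1.and (hmem ⟨⟨1, fun _ => 0⟩, {fun _ => a}⟩)).exists
      exact hx'.2 (by simpa using funext hx)
  · filter_upwards [hmem ⟨⟨1, fun _ => 0⟩, ∅⟩] with x hx using hx.1.2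

theorem eventually_monochromatic {n : ℕ} {U : Filter (Fin n → ℕ+)} {u : Ultrafilter ℕ+}
    (hU : ∀ i, Tendsto (fun x : Fin n → ℕ+ => x i) U u) (τ : ℕ+ → ℕ+) {k : ℕ} (c : ℕ+ → Fin k) :
    ∀ᶠ x in U, Monochromatic c (Set.range fun i => τ (x i)) := by
  obtain ⟨j, hj⟩ := (u.map fun y => c (τ y)).eq_pure_of_finite
  have h : ∀ᶠ y in u, c (τ y) = j := by
    have : {j} ∈ u.map fun y => c (τ y) := by simp [hj]
    exact this
  have h' : ∀ᶠ x in U, ∀ i, c (τ (x i)) = j := eventually_all.2 fun i => (hU i).eventually h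
  filter_upwards [h'] with x hx
  refine ⟨j, ?_⟩
  rintro _ ⟨i, rfl⟩
  exact hx i

/-- A single coordinate suffices: `τ (x i₀)` eventually leaves the finite set of `i₀`-th coordinates
of `A`. -/
theorem infinite_of_eventually {n : ℕ} [Nonempty (Fin n)] {U : Ultrafilter (Fin n → ℕ+)}
    {u : Ultrafilter ℕ+} (hU : ∀ i, Tendsto (fun x : Fin n → ℕ+ => x i) U u) {τ : ℕ+ → ℕ+}
    (hτ : Tendsto τ u cofinite) {A : Set (Fin n → ℕ+)} (hA : ∀ᶠ x : Fin n → ℕ+ in U, (fun i => τ (x i)) ∈ A) :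
    A.Infinite := by
  intro hfin
  obtain ⟨i₀⟩ := ‹Nonempty (Fin n)›
  have h := (hτ.comp (hU i₀)).eventually (hfin.image fun t => t i₀).eventually_cofinite_notMem
  obtain ⟨x, hx, hx'⟩ := (h.and hA).exists
  exact hx ⟨_, hx', rfl⟩

/-! ### Blocks of bounded relative weight -/

theorem exists_eventually_eq_or_tendsto_atTop {X : Type*} (U : Ultrafilter X) (g : X → ℕ) :
    (∃ b, ∀ᶠ x in U, g x = b) ∨ Tendsto g U atTop := by
  rcases (U.map g).le_cofinite_or_eq_pure with h | ⟨b, hb⟩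
  · right
    rw [← Nat.cofinite_eq_atTop]
    exact h
  · left
    refine ⟨b, ?_⟩
    have : {b} ∈ U.map g := by simp [hb]
    exact this

/-- Along an ultrafilter, an increasing sequence of integers has an initial segment of constant
shape, followed by a gap that tends to infinity. -/
theorem exists_initial_segment {X : Type*} (U : Ultrafilter X) {ℓ : ℕ} (M : X → Fin (ℓ + 1) → ℤ)
    (hM : ∀ᶠ x in U, StrictMono (M x)) :
    ∃ (m : ℕ) (hm : m ≤ ℓ) (e : Fin (m + 1) → ℕ), e 0 = 0 ∧
      (∀ᶠ x in U, ∀ j, M x (Fin.castLE (Nat.succ_le_succ hm) j) = M x 0 + e j) ∧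
      ∀ h : m < ℓ, Tendsto (fun x => M x ⟨m + 1, by omega⟩ - M x ⟨m, by omega⟩) U atTop := by
  classical
  -- `p ℓ` holds vacuously, so a least `m` exists; every earlier gap fails to tend to infinity and
  -- is therefore constant along `U`.
  let p : ℕ → Prop := fun m => ∀ h : m < ℓ,
    Tendsto (fun x => M x ⟨m + 1, by omega⟩ - M x ⟨m, by omega⟩) U atTop
  have hp : ∃ m, p m := ⟨ℓ, fun h => absurd h (lt_irrefl _)⟩
  have hmℓ : Nat.find hp ≤ ℓ := Nat.find_min' hp fun h => absurd h (lt_irrefl _)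
  have key : ∀ j (hj : j < Nat.find hp + 1),
      ∃ b : ℕ, ∀ᶠ x in U, M x ⟨j, by omega⟩ = M x 0 + b := by
    intro j
    induction j with
    | zero => exact fun _ => ⟨0, .of_forall fun x => by simp⟩
    | succ j ih =>
      intro hj
      obtain ⟨b, hb⟩ := ih (by omega)
      have hnot := Nat.find_min hp (show j < Nat.find hp by omega)
      simp only [p, not_forall] at hnot
      obtain ⟨hjℓ, hnot⟩ := hnot
      have hcast : ∀ᶠ x in U, ((M x ⟨j + 1, by omega⟩ - M x ⟨j, by omega⟩).toNat : ℤ) =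
          M x ⟨j + 1, by omega⟩ - M x ⟨j, by omega⟩ := by
        filter_upwards [hM] with x hx
        have : M x ⟨j, by omega⟩ < M x ⟨j + 1, by omega⟩ := hx (by simp [Fin.lt_def])
        omega
      rcases exists_eventually_eq_or_tendsto_atTop U
        (fun x => (M x ⟨j + 1, by omega⟩ - M x ⟨j, by omega⟩).toNat) with ⟨b', hb'⟩ | h
      · refine ⟨b + b', ?_⟩
        filter_upwards [hb, hb', hcast] with x h1 h2 h3
        push_cast
        omega
      · exact absurd ((tendsto_natCast_atTop_atTop.comp h).congr' hcast) hnot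
  choose e he using fun j : Fin (Nat.find hp + 1) => key j j.2
  refine ⟨Nat.find hp, hmℓ, e, ?_, ?_, Nat.find_spec hp⟩
  · obtain ⟨x, hx⟩ := (he 0).exists
    have : M x 0 = M x 0 + e 0 := hx
    omega
  · exact eventually_all.2 he

/-- The order pattern of the values `φ x α` is one of finitely many, hence constant along `U`. A
reference point `x₀` fixes the blocks, and a representative of each block defines `M x` for all `x`.
-/
theorem exists_blocks {X ι : Type*} [DecidableEq ι] (U : Ultrafilter X) {S : Finset ι}
    (hS : S.Nonempty) (φ : X → ι → ℤ) :
    ∃ (ℓ : ℕ) (J : Fin (ℓ + 1) → Finset ι) (M : X → Fin (ℓ + 1) → ℤ), ∀ᶠ x in U,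
      StrictMono (M x) ∧ Set.range (M x) = φ x '' S ∧
        ∀ i, J i = S.filter fun α => φ x α = M x i := by
  classical
  obtain ⟨R, hR⟩ := (U.map fun x => fun α β : S => decide (φ x α ≤ φ x β)).eq_pure_of_finite
  have hR' : ∀ᶠ x in U, (fun α β : S => decide (φ x α ≤ φ x β)) = R := by
    have : {R} ∈ U.map fun x => fun α β : S => decide (φ x α ≤ φ x β) := by simp [hR]
    exact this
  obtain ⟨x₀, hx₀⟩ := hR'.exists
  have hle : ∀ᶠ x in U, ∀ α ∈ S, ∀ β ∈ S, (φ x α ≤ φ x β ↔ φ x₀ α ≤ φ x₀ β) := by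
    filter_upwards [hR'] with x hx α hα β hβ
    have := congrFun (congrFun (hx.trans hx₀.symm) ⟨α, hα⟩) ⟨β, hβ⟩
    simpa using this
  obtain ⟨ℓ, hℓ⟩ : ∃ ℓ, (S.image (φ x₀)).card = ℓ + 1 :=
    Nat.exists_eq_succ_of_ne_zero (Finset.card_pos.2 (hS.image _)).ne'
  let M₀ := (S.image (φ x₀)).orderEmbOfFin hℓ
  have hM₀ : ∀ i, ∃ α ∈ S, φ x₀ α = M₀ i := fun i => by
    exact Finset.mem_image.1 ((S.image (φ x₀)).orderEmbOfFin_mem hℓ i)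
  choose rep hrep hrepM using hM₀
  have hsurj : ∀ α ∈ S, ∃ i, φ x₀ α = φ x₀ (rep i) := by
    intro α hα
    have : φ x₀ α ∈ Set.range M₀ := by
      rw [Finset.range_orderEmbOfFin]
      exact Finset.mem_coe.2 (Finset.mem_image_of_mem _ hα)
    obtain ⟨i, hi⟩ := this
    exact ⟨i, by rw [hrepM, hi]⟩
  refine ⟨ℓ, fun i => S.filter fun α => φ x₀ α = M₀ i, fun x i => φ x (rep i), ?_⟩
  filter_upwards [hle] with x hx
  have heq : ∀ α ∈ S, ∀ β ∈ S, (φ x α = φ x β ↔ φ x₀ α = φ x₀ β) := fun α hα β hβ => by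
    rw [le_antisymm_iff, le_antisymm_iff, hx α hα β hβ, hx β hβ α hα]
  refine ⟨fun i j hij => ?_, ?_, fun i => ?_⟩
  · rw [← not_le, hx _ (hrep j) _ (hrep i), not_le, hrepM, hrepM]
    exact M₀.strictMono hij
  · ext y
    constructor
    · rintro ⟨i, rfl⟩
      exact ⟨rep i, hrep i, rfl⟩
    · rintro ⟨α, hα, rfl⟩
      obtain ⟨i, hi⟩ := hsurj α hα
      exact ⟨i, (heq _ (hrep i) _ hα).2 hi.symm⟩
  · refine Finset.filter_congr fun α hα => ?_
    rw [heq α hα _ (hrep i), hrepM]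

theorem sum_eq_sum_blocks {ι R A : Type*} [DecidableEq ι] [LinearOrder R] [AddCommMonoid A] {ℓ : ℕ}
    {S : Finset ι} {φ : ι → R} {M : Fin ℓ → R} {J : Fin ℓ → Finset ι} (hM : StrictMono M)
    (hr : Set.range M = φ '' S) (hJ : ∀ i, J i = S.filter fun α => φ α = M i) (f : ι → A) :
    ∑ α ∈ S, f α = ∑ i, ∑ α ∈ J i, f α := by
  rw [← Finset.sum_biUnion]
  · refine Finset.sum_congr ?_ fun _ _ => rfl
    ext α
    simp only [Finset.mem_biUnion, Finset.mem_univ, true_and, hJ, Finset.mem_filter]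
    refine ⟨fun hα => ?_, fun ⟨i, hi⟩ => hi.1⟩
    obtain ⟨i, hi⟩ : φ α ∈ Set.range M := hr ▸ ⟨α, hα, rfl⟩
    exact ⟨i, hα, hi.symm⟩
  · intro i _ j _ hij
    rw [Function.onFun, Finset.disjoint_left]
    intro α hi hj
    rw [hJ, Finset.mem_filter] at hi hj
    exact hij (hM.injective (hi.2.symm.trans hj.2))

/-- The limit along `U` of the vanishing sums `∑ r ^ φ(α) v(α)`, where `‖r‖ < 1`, divided by
their dominant powers of `r`. -/
theorem exists_dominant_blocks {X ι K : Type*} [DecidableEq ι] [NormedField K]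
    (U : Ultrafilter X) {S : Finset ι} (hS : S.Nonempty) (φ : X → ι → ℤ) {r : K} (hr0 : r ≠ 0)
    (hr1 : ‖r‖ < 1) {v : X → ι → K} {v' : ι → K}
    (hv : ∀ α ∈ S, Tendsto (fun x => v x α) U (𝓝 (v' α)))
    (h0 : ∀ᶠ x in U, ∑ α ∈ S, r ^ φ x α * v x α = 0) :
    ∃ (ℓ m : ℕ) (hm : m ≤ ℓ) (J : Fin (ℓ + 1) → Finset ι) (e : Fin (m + 1) → ℕ)
      (M : X → Fin (ℓ + 1) → ℤ), e 0 = 0 ∧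
      (∀ᶠ x in U, (StrictMono (M x) ∧ Set.range (M x) = φ x '' S ∧
        ∀ i, J i = S.filter fun α => φ x α = M x i) ∧
        ∀ j, M x (Fin.castLE (Nat.succ_le_succ hm) j) = M x 0 + e j) ∧
      (∀ h : m < ℓ, Tendsto (fun x => M x ⟨m + 1, by omega⟩ - M x ⟨m, by omega⟩) U atTop) ∧
      ∑ j, r ^ e j * ∑ α ∈ J (Fin.castLE (Nat.succ_le_succ hm) j), v' α = 0 := by
  obtain ⟨ℓ, J, M, hM⟩ := exists_blocks U hS φ
  obtain ⟨m, hm, e, he0, he, hgap⟩ := exists_initial_segment U M (hM.mono fun x hx => hx.1)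
  refine ⟨ℓ, m, hm, J, e, M, he0, hM.and he, hgap, ?_⟩
  have hJS : ∀ i, J i ⊆ S := by
    obtain ⟨x, -, -, hx⟩ := hM.exists
    exact fun i => hx i ▸ Finset.filter_subset _ _
  -- The limits of `r ^ (M x i - M x 0)`: constant up to index `m`, zero beyond the gap because `‖r‖
  -- < 1`.
  let a : Fin (ℓ + 1) → K := fun i => if h : (i : ℕ) < m + 1 then r ^ e ⟨i, h⟩ else 0
  have ha : ∀ i, Tendsto (fun x => r ^ (M x i - M x 0)) U (𝓝 (a i)) := by
    intro i
    by_cases hi : (i : ℕ) < m + 1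
    · simp only [a, hi, dif_pos]
      refine tendsto_const_nhds.congr' ?_
      filter_upwards [he] with x hx
      have : M x i = M x 0 + e ⟨i, hi⟩ := hx ⟨i, hi⟩
      rw [this, add_sub_cancel_left, zpow_natCast]
    · simp only [a, hi, dif_neg, not_false_eq_true]
      have htop : Tendsto (fun x => M x i - M x 0) U atTop := by
        refine tendsto_atTop_mono' _ ?_ (hgap (by omega))
        filter_upwards [hM] with x hx
        have h1 : M x ⟨m + 1, by omega⟩ ≤ M x i := hx.1.monotone (by simp [Fin.le_def]; omega)
        have h2 : M x 0 ≤ M x ⟨m, by omega⟩ := hx.1.monotone (Fin.zero_le _)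
        omega
      have hnat : Tendsto (fun x => (M x i - M x 0).toNat) U atTop := by
        rw [tendsto_atTop]
        intro N
        filter_upwards [htop.eventually_ge_atTop (N : ℤ)] with x hx
        omega
      refine ((tendsto_pow_atTop_nhds_zero_of_norm_lt_one hr1).comp hnat).congr' ?_
      filter_upwards [htop.eventually_ge_atTop 0] with x hx
      rw [Function.comp_apply, ← zpow_natCast, Int.toNat_of_nonneg hx]
  have hlim : Tendsto (fun x => ∑ i, r ^ (M x i - M x 0) * ∑ α ∈ J i, v x α) U
      (𝓝 (∑ i, a i * ∑ α ∈ J i, v' α)) :=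
    tendsto_finsetSum _ fun i _ => (ha i).mul (tendsto_finsetSum _ fun α hα => hv α (hJS i hα))
  have hzero : ∀ᶠ x in U, ∑ i, r ^ (M x i - M x 0) * ∑ α ∈ J i, v x α = 0 := by
    filter_upwards [h0, hM] with x hx hMx
    have : ∑ i, r ^ (M x i - M x 0) * ∑ α ∈ J i, v x α =
        r ^ (-M x 0) * ∑ α ∈ S, r ^ φ x α * v x α := by
      rw [sum_eq_sum_blocks hMx.1 hMx.2.1 hMx.2.2, Finset.mul_sum]
      refine Finset.sum_congr rfl fun i _ => ?_
      rw [Finset.mul_sum, Finset.mul_sum]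
      refine Finset.sum_congr rfl fun α hα => ?_
      rw [hMx.2.2 i, Finset.mem_filter] at hα
      rw [hα.2, ← mul_assoc, ← zpow_add₀ hr0, neg_add_eq_sub]
    rw [this, hx, mul_zero]
  have := tendsto_nhds_unique (hlim.congr' hzero) tendsto_const_nhds
  rw [← this]
  refine Fintype.sum_of_injective (Fin.castLE (Nat.succ_le_succ hm)) (Fin.castLE_injective _) _ _
    ?_ ?_
  · intro i hi
    have : ¬ (i : ℕ) < m + 1 := fun h => hi ⟨⟨i, h⟩, rfl⟩
    simp only [a, dif_neg this, zero_mul]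
  · intro j
    have : ((Fin.castLE (Nat.succ_le_succ hm) j : Fin (ℓ + 1)) : ℕ) < m + 1 := j.2
    simp only [a, this, dif_pos]
    rfl

/-! ### The maximal and minimal Rado conditions -/

theorem tendsto_toPNat'_cofinite {X : Type*} {F : Filter X} {g : X → ℕ} (hg : Tendsto g F atTop) :
    (∀ᶠ x in F, ((g x).toPNat' : ℕ) = g x) ∧ Tendsto (fun x => (g x).toPNat') F cofinite := by
  have h : ∀ᶠ x in F, ((g x).toPNat' : ℕ) = g x := by
    filter_upwards [hg.eventually_gt_atTop 0] with x hx
    rw [Nat.toPNat'_coe, if_pos hx]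
  refine ⟨h, ?_⟩
  rw [← PNat.coe_injective.comap_cofinite_eq, tendsto_comap_iff, Nat.cofinite_eq_atTop]
  exact hg.congr' (h.mono fun x hx => hx.symm)

/-- The source of the linear functionals: scaling the `i`-th variable by `s ^ t i` scales the
monomial `α` by `s ^ weight t α`. -/
theorem aeval_eq_sum_weight {n : ℕ} {R : Type*} [CommRing R] (P : MvPolynomial (Fin n) ℤ) (s : R)
    (t : Fin n → ℕ+) (w : Fin n → R) :
    MvPolynomial.aeval (fun i => s ^ (t i : ℕ) * w i) P =
      ∑ α ∈ P.support, s ^ weight t α * (((P.coeff α : ℤ) : R) * ∏ i, w i ^ α i) := by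
  rw [MvPolynomial.aeval_def, MvPolynomial.eval₂_eq']
  refine Finset.sum_congr rfl fun α _ => ?_
  simp only [mul_pow, Finset.prod_mul_distrib, ← pow_mul, Finset.prod_pow_eq_pow_sum, weight,
    algebraMap_int_eq, eq_intCast]
  ring

theorem aeval_natCast_of_eval_eq_zero {n : ℕ} {R : Type*} [CommRing R]
    {P : MvPolynomial (Fin n) ℤ} {x : Fin n → ℕ+}
    (hx : MvPolynomial.eval (fun i => ((x i : ℕ) : ℤ)) P = 0) :
    MvPolynomial.aeval (fun i => ((x i : ℕ) : R)) P = 0 := by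
  have := MvPolynomial.aeval_algebraMap_apply R (fun i => ((x i : ℕ) : ℤ)) P
  rw [MvPolynomial.aeval_eq_eval, hx] at this
  simpa [Function.comp_def] using this

theorem aeval_radoPolynomial {n m : ℕ} {A : Type*} [CommRing A] (c : (Fin n →₀ ℕ) → ℤ) (q : ℕ)
    (J : Fin (m + 1) → Finset (Fin n →₀ ℕ)) (e : Fin (m + 1) → ℕ) (w : A) :
    Polynomial.aeval w (radoPolynomial c q J e) =
      ∑ i, (q : A) ^ e i * ∑ α ∈ J i, (c α : A) * w ^ (∑ j, α j) := by
  simp [radoPolynomial]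

theorem tendsto_coeff_mul_prod {n : ℕ} {X K : Type*} [NormedField K] {F : Filter X} (c : K)
    {f : X → Fin n → K} {w : K} (hf : ∀ i, Tendsto (fun x => f x i) F (𝓝 w)) (α : Fin n →₀ ℕ) :
    Tendsto (fun x => c * ∏ i, f x i ^ α i) F (𝓝 (c * w ^ (∑ i, α i))) := by
  rw [← Finset.prod_pow_eq_pow_sum]
  exact tendsto_const_nhds.mul (tendsto_finsetProd _ fun i _ => (hf i).pow _)

/-! ### The real case: logarithms in base `q` -/

theorem tendsto_log_cofinite {q : ℕ} (hq : 2 ≤ q) :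
    Tendsto (fun y : ℕ+ => Nat.log q y) cofinite atTop := by
  have h : Tendsto (Nat.log q) atTop atTop :=
    tendsto_atTop_atTop.2 fun b => ⟨q ^ b, fun a ha => Nat.le_log_of_pow_le (by omega) ha⟩
  rw [← Nat.cofinite_eq_atTop] at h
  rw [← Nat.cofinite_eq_atTop]
  exact h.comp PNat.coe_injective.tendsto_cofinite

theorem PartitionRegular.maximalRadoCondition {n : ℕ} {P : MvPolynomial (Fin n) ℤ}
    (hP : PartitionRegular P) (hP0 : P ≠ 0) : MaximalRadoCondition P := by
  intro q hq
  have := hP.nonempty_index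
  obtain ⟨U, u, hU, hu, hzero⟩ := hP.exists_ultrafilter
  have hq1 : (1 : ℝ) < q := by exact_mod_cast hq
  have hq0 : (q : ℝ) ≠ 0 := by positivity
  obtain ⟨hτg, hτ⟩ := tendsto_toPNat'_cofinite ((tendsto_log_cofinite hq).mono_left hu)
  set τ : ℕ+ → ℕ+ := fun y => (Nat.log q y).toPNat' with hτdef
  let f : ℕ+ → ℝ := fun y => (y : ℕ) / (q : ℝ) ^ (τ y : ℕ)
  have hf : ∀ᶠ y in u, f y ∈ Set.Icc (1 : ℝ) q := by
    filter_upwards [hτg] with y hy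
    have hpos : (0 : ℝ) < (q : ℝ) ^ (τ y : ℕ) := by positivity
    refine ⟨(one_le_div hpos).2 ?_, (div_le_iff₀ hpos).2 ?_⟩
    · have := Nat.pow_log_le_self q y.ne_zero
      rw [← hy] at this
      exact_mod_cast this
    · have := (Nat.lt_pow_succ_log_self hq y).le
      rw [← hy, pow_succ, mul_comm] at this
      exact_mod_cast this
  obtain ⟨w, hw, hfw⟩ := isCompact_Icc.ultrafilter_le_nhds (u.map f) (tendsto_principal.2 hf)
  have hfw' : Tendsto f u (𝓝 w) := hfw
  -- With base `q⁻¹` and exponents `-weight`, the largest weight gives the dominant term, as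
  -- `exists_dominant_blocks` requires.
  have hsum : ∀ᶠ x : Fin n → ℕ+ in U, ∑ α ∈ P.support,
      ((q : ℝ)⁻¹) ^ (-(weight (fun i => τ (x i)) α : ℤ)) *
        (((P.coeff α : ℤ) : ℝ) * ∏ i, f (x i) ^ α i) = 0 := by
    filter_upwards [hzero] with x hx
    have h := aeval_natCast_of_eval_eq_zero (R := ℝ) hx
    have hfx : ∀ i, ((x i : ℕ) : ℝ) = (q : ℝ) ^ (τ (x i) : ℕ) * f (x i) := fun i =>
      (mul_div_cancel₀ _ (pow_ne_zero _ hq0)).symm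
    simp only [hfx] at h
    rw [aeval_eq_sum_weight P (q : ℝ) (fun i => τ (x i))] at h
    simpa using h
  obtain ⟨ℓ, m, hm, J, e, M, he0, hM, hgap, hroot⟩ := exists_dominant_blocks U
    (MvPolynomial.support_nonempty.2 hP0) _ (inv_ne_zero hq0)
    (by rw [norm_inv, Real.norm_natCast]; exact inv_lt_one_of_one_lt₀ hq1)
    (fun α _ => tendsto_coeff_mul_prod ((P.coeff α : ℤ) : ℝ) (fun i => hfw'.comp (hU i)) α) hsum
  have he : StrictMono e := by
    obtain ⟨x, ⟨hx, -⟩, hxe⟩ := hM.exists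
    intro i j hij
    have := hx ((Fin.castLE_lt_castLE_iff (Nat.succ_le_succ hm)).2 hij)
    rw [hxe, hxe] at this
    omega
  -- `e` measures the descent from the top weight, whereas an upper functional measures heights
  -- above the `m`-th one.
  refine ⟨ℓ, m, hm, J, fun j => e (Fin.last m) - e j.castSucc,
    ⟨hm, fun j => Nat.sub_pos_of_lt (he (Fin.castSucc_lt_last j)), fun k c N => ?_⟩, w, hw, ?_⟩
  · refine infinite_of_eventually hU hτ ?_
    have hgapN : ∀ᶠ x in U, ∀ h : m < ℓ, (N : ℤ) ≤ M x ⟨m + 1, by omega⟩ - M x ⟨m, by omega⟩ :=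
      eventually_all.2 fun h => (hgap h).eventually_ge_atTop _
    filter_upwards [eventually_monochromatic hU τ c, hM, hgapN] with x hc ⟨⟨hmono, hr, hJ⟩, hxe⟩ hN
    have hcast : ∀ i, ((-M x i).toNat : ℤ) = -M x i := fun i => by
      have hmem := Set.mem_range_self (f := M x) i
      rw [hr] at hmem
      obtain ⟨α, -, hα⟩ := hmem
      beta_reduce at hα
      omega
    refine ⟨hc, fun i => (-M x i).toNat, ⟨fun i j hij => ?_, ?_, fun i => ?_⟩, fun j => ?_,
      fun h => ?_⟩
    · have h1 := hmono (Fin.rev_lt_rev.2 hij)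
      have h2 := hcast i.rev
      have h3 := hcast j.rev
      simp only [Function.comp_apply]
      omega
    · rw [Fin.rev_surjective.range_comp]
      ext y
      have h := Set.ext_iff.1 hr (-(y : ℤ))
      simp only [Set.mem_range, Set.mem_image, neg_inj, Nat.cast_inj] at h
      rw [Set.mem_image, ← h, Set.mem_range]
      refine exists_congr fun i => ?_
      have := hcast i
      omega
    · rw [Function.comp_apply, hJ]
      refine Finset.filter_congr fun α _ => ?_
      have := hcast i.rev
      simp only [Function.comp_apply]
      omega
    · have h1 : M x ⟨j, by omega⟩ = M x 0 + e j.castSucc := hxe j.castSucc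
      have h2 : M x ⟨m, by omega⟩ = M x 0 + e (Fin.last m) := hxe (Fin.last m)
      have h3 := hcast ⟨j, by omega⟩
      have h4 := hcast ⟨m, by omega⟩
      have h5 := he (Fin.castSucc_lt_last j)
      beta_reduce
      omega
    · have h1 := hN h
      have h2 := hcast ⟨m + 1, by omega⟩
      have h3 := hcast ⟨m, by omega⟩
      simp only
      omega
  · have hd : ∀ j : Fin (m + 1), Fin.snoc (α := fun _ => ℕ)
        (fun j : Fin m => e (Fin.last m) - e j.castSucc) 0 j = e (Fin.last m) - e j := by
      intro j
      induction j using Fin.lastCases <;> simp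
    -- Multiplying the limit equation by `q ^ e_m` turns `q⁻¹ ^ e_j` into `q ^ (e_m - e_j)`.
    rw [aeval_radoPolynomial, ← mul_zero ((q : ℝ) ^ e (Fin.last m)), ← hroot, Finset.mul_sum]
    refine Finset.sum_congr rfl fun j _ => ?_
    rw [hd, pow_sub₀ _ hq0 (he.monotone (Fin.le_last j)), inv_pow, mul_assoc]

/-! ### The `p`-adic case: translation to a root and valuations -/

theorem aeval_translate {n : ℕ} {R : Type*} [CommRing R] [Algebra ℤ R] (P : MvPolynomial (Fin n) ℤ) (a : ℤ)
    (y : Fin n → R) :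
    MvPolynomial.aeval y (translate a P) = MvPolynomial.aeval (fun i => y i + (a : R)) P := by
  rw [translate, ← AlgHom.comp_apply, MvPolynomial.comp_aeval]
  simp

theorem aeval_diag {n : ℕ} {R : Type*} [CommRing R] (P : MvPolynomial (Fin n) ℤ) (y : R) :
    Polynomial.aeval y (diag P) = MvPolynomial.aeval (fun _ => y) P := by
  rw [diag, ← AlgHom.comp_apply, MvPolynomial.comp_aeval]
  simp

/-- Evaluating the translate at `X - a` in every variable recovers `diag P`. -/
theorem translate_ne_zero {n : ℕ} {P : MvPolynomial (Fin n) ℤ} (hP : diag P ≠ 0) (a : ℤ) :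
    translate a P ≠ 0 := by
  intro h
  have := aeval_translate P a fun _ => (Polynomial.X - Polynomial.C a : Polynomial ℤ)
  rw [h, map_zero] at this
  exact hP (by rw [diag]; simpa using this.symm)

/-- The limit in `ℤ_p` of the solutions is an integer root of the diagonal polynomial. -/
theorem exists_root_tendsto {n : ℕ} {P : MvPolynomial (Fin n) ℤ} (hP0 : diag P ≠ 0)
    (hsplit : (diag P).Splits) (p : ℕ) [Fact p.Prime] {U : Ultrafilter (Fin n → ℕ+)}
    {u : Ultrafilter ℕ+} (hU : ∀ i, Tendsto (fun x : Fin n → ℕ+ => x i) U u)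
    (hzero : ∀ᶠ x : Fin n → ℕ+ in U, MvPolynomial.eval (fun i => ((x i : ℕ) : ℤ)) P = 0) :
    ∃ a : ℤ, (diag P).IsRoot a ∧ Tendsto (fun y : ℕ+ => ((y : ℕ) : ℤ_[p])) u (𝓝 (a : ℤ_[p])) := by
  obtain ⟨ξ, -, hξ⟩ := isCompact_univ.ultrafilter_le_nhds
    (u.map fun y : ℕ+ => ((y : ℕ) : ℤ_[p])) (by simp)
  have hξ' : Tendsto (fun y : ℕ+ => ((y : ℕ) : ℤ_[p])) u (𝓝 ξ) := hξ
  have hlim : Tendsto (fun x : Fin n → ℕ+ =>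
      MvPolynomial.aeval (fun i => ((x i : ℕ) : ℤ_[p])) P) U
      (𝓝 (MvPolynomial.aeval (fun _ => ξ) P)) := by
    simp only [MvPolynomial.aeval_def, MvPolynomial.eval₂_eq']
    exact tendsto_finsetSum _ fun α _ => tendsto_const_nhds.mul
      (tendsto_finsetProd _ fun i _ => (hξ'.comp (hU i)).pow _)
  have hroot : Polynomial.aeval ξ (diag P) = 0 := by
    rw [aeval_diag]
    exact tendsto_nhds_unique
      (hlim.congr' (hzero.mono fun x hx => aeval_natCast_of_eval_eq_zero hx)) tendsto_const_nhds
  have hinj : Function.Injective (Int.castRingHom ℤ_[p]) := Int.cast_injective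
  have hmem : ξ ∈ ((diag P).map (Int.castRingHom ℤ_[p])).roots := by
    rw [Polynomial.mem_roots ((Polynomial.map_ne_zero_iff hinj).2 hP0), Polynomial.IsRoot,
      Polynomial.eval_map, ← algebraMap_int_eq, ← Polynomial.aeval_def]
    exact hroot
  -- Splitting over `ℤ` leaves no new roots in `ℤ_[p]`, so `ξ` is an integer.
  rw [hsplit.roots_map_of_injective hinj, Multiset.mem_map] at hmem
  obtain ⟨a, har, ha⟩ := hmem
  refine ⟨a, (Polynomial.mem_roots hP0).1 har, ?_⟩
  rwa [← ha, eq_intCast] at hξ'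

theorem tendsto_valuation_atTop {X : Type*} {p : ℕ} [Fact p.Prime] {F : Filter X}
    {f : X → ℤ_[p]} (hf : Tendsto f F (𝓝 0)) (h0 : ∀ᶠ x in F, f x ≠ 0) :
    Tendsto (fun x => (f x).valuation) F atTop := by
  rw [tendsto_atTop]
  intro N
  have hp : (0 : ℝ) < (p : ℝ) ^ (-(N : ℤ)) :=
    zpow_pos (by exact_mod_cast (Fact.out : p.Prime).pos) _
  have hn : Tendsto (fun x => ‖f x‖) F (𝓝 0) := by simpa using hf.norm
  filter_upwards [h0, hn.eventually_lt_const hp] with x hx hlt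
  exact (PadicInt.norm_le_pow_iff_le_valuation _ hx N).1 hlt.le

theorem PartitionRegular.minimalRadoCondition {n : ℕ} {P : MvPolynomial (Fin n) ℤ}
    (hP : PartitionRegular P) (hP0 : diag P ≠ 0) (hsplit : (diag P).Splits) :
    MinimalRadoCondition P := by
  classical
  intro p _
  have := hP.nonempty_index
  obtain ⟨U, u, hU, hu, hzero⟩ := hP.exists_ultrafilter
  obtain ⟨a, ha, hlim⟩ := exists_root_tendsto hP0 hsplit p hU hzero
  refine ⟨a, ha, ?_⟩
  have hp0 : (p : ℚ_[p]) ≠ 0 := by exact_mod_cast (Fact.out : p.Prime).ne_zero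
  let δ : ℕ+ → ℤ_[p] := fun y => ((y : ℕ) : ℤ_[p]) - a
  have hδ : Tendsto δ u (𝓝 0) := by simpa using hlim.sub_const (a : ℤ_[p])
  have hδ0 : ∀ᶠ y in u, δ y ≠ 0 := by
    have hinj : Function.Injective δ := fun y z h => PNat.coe_injective (by simpa [δ] using h)
    have := (Set.finite_singleton (0 : ℤ_[p])).preimage hinj.injOn
    exact hu this.eventually_cofinite_notMem
  obtain ⟨hτg, hτ⟩ := tendsto_toPNat'_cofinite (tendsto_valuation_atTop hδ hδ0)
  set τ : ℕ+ → ℕ+ := fun y => (δ y).valuation.toPNat' with hτdef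
  -- The default `1` serves only a possible `y = a`, which is `u`-negligible, and keeps `f` inside
  -- the compact unit sphere.
  let f : ℕ+ → ℤ_[p] := fun y => if h : δ y ≠ 0 then PadicInt.unitCoeff h else 1
  have hf1 : ∀ y, ‖f y‖ = 1 := fun y => by
    by_cases h : δ y ≠ 0
    · simp only [f, dif_pos h, PadicInt.norm_units]
    · simp only [f, dif_neg h, norm_one]
  have hfδ : ∀ᶠ y : ℕ+ in u, ((y : ℕ) : ℚ_[p]) = (p : ℚ_[p]) ^ (τ y : ℕ) * f y + a := by
    filter_upwards [hτg, hδ0] with y hy hy0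
    have h := PadicInt.unitCoeff_spec hy0
    rw [← hy] at h
    have h' : ((y : ℕ) : ℤ_[p]) = (p : ℤ_[p]) ^ (τ y : ℕ) * f y + a := by
      simp only [f, dif_pos hy0]
      rw [mul_comm, ← h]
      simp [δ]
    exact_mod_cast congrArg ((↑) : ℤ_[p] → ℚ_[p]) h'
  obtain ⟨w, hw, hfw⟩ := (isClosed_eq continuous_norm continuous_const :
    IsClosed {z : ℤ_[p] | ‖z‖ = 1}).isCompact.ultrafilter_le_nhds (u.map f)
    (tendsto_principal.2 (.of_forall hf1))
  have hfw' : Tendsto (fun y => (f y : ℚ_[p])) u (𝓝 (w : ℚ_[p])) :=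
    (continuous_subtype_val.tendsto w).comp (show Tendsto f u (𝓝 w) from hfw)
  have hsum : ∀ᶠ x : Fin n → ℕ+ in U, ∑ α ∈ (translate a P).support,
      (p : ℚ_[p]) ^ (weight (fun i => τ (x i)) α : ℤ) *
        ((((translate a P).coeff α : ℤ) : ℚ_[p]) * ∏ i, (f (x i) : ℚ_[p]) ^ α i) = 0 := by
    filter_upwards [hzero, eventually_all.2 fun i => (hU i).eventually hfδ] with x hx hfx
    have h := aeval_natCast_of_eval_eq_zero (R := ℚ_[p]) hx
    simp only [hfx] at h
    rw [← aeval_translate, aeval_eq_sum_weight (translate a P) (p : ℚ_[p]) (fun i => τ (x i))] at h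
    simpa using h
  obtain ⟨ℓ, m, hm, J, e, M, he0, hM, hgap, hroot⟩ := exists_dominant_blocks U
    (MvPolynomial.support_nonempty.2 (translate_ne_zero hP0 a)) _ hp0 Padic.norm_p_lt_one
    (fun α _ => tendsto_coeff_mul_prod (((translate a P).coeff α : ℤ) : ℚ_[p])
      (fun i => hfw'.comp (hU i)) α) hsum
  refine ⟨ℓ, m, hm, J, fun j => e j.succ, ⟨hm, fun j => ?_, fun k c N => ?_⟩, w,
    PadicInt.isUnit_iff.2 hw, ?_⟩
  · obtain ⟨x, ⟨hx, -⟩, hxe⟩ := hM.exists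
    have := hx ((Fin.castLE_lt_castLE_iff (Nat.succ_le_succ hm)).2 j.succ_pos)
    rw [hxe, hxe, he0] at this
    beta_reduce
    omega
  · refine infinite_of_eventually hU hτ ?_
    have hgapN : ∀ᶠ x in U, ∀ h : m < ℓ, (N : ℤ) ≤ M x ⟨m + 1, by omega⟩ - M x ⟨m, by omega⟩ :=
      eventually_all.2 fun h => (hgap h).eventually_ge_atTop _
    filter_upwards [eventually_monochromatic hU τ c, hM, hgapN] with x hc ⟨⟨hmono, hr, hJ⟩, hxe⟩ hN
    have hcast : ∀ i, ((M x i).toNat : ℤ) = M x i := fun i => by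
      have hmem := Set.mem_range_self (f := M x) i
      rw [hr] at hmem
      obtain ⟨α, -, hα⟩ := hmem
      beta_reduce at hα
      omega
    refine ⟨hc, fun i => (M x i).toNat, ⟨fun i j hij => ?_, ?_, fun i => ?_⟩, fun j => ?_,
      fun h => ?_⟩
    · have h1 := hmono hij
      have h2 := hcast i
      have h3 := hcast j
      simp only
      omega
    · ext y
      have h := Set.ext_iff.1 hr (y : ℤ)
      simp only [Set.mem_range, Set.mem_image, Nat.cast_inj] at h
      rw [Set.mem_image, ← h, Set.mem_range]
      refine exists_congr fun i => ?_
      have := hcast i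
      omega
    · rw [hJ]
      refine Finset.filter_congr fun α _ => ?_
      have := hcast i
      beta_reduce
      omega
    · have h1 : M x ⟨j + 1, by omega⟩ = M x 0 + e j.succ := hxe j.succ
      have h3 := hcast ⟨j + 1, by omega⟩
      have h4 := hcast 0
      beta_reduce
      omega
    · have h1 := hN h
      have h2 := hcast ⟨m + 1, by omega⟩
      have h3 := hcast ⟨m, by omega⟩
      simp only
      omega
  · have hd : ∀ j : Fin (m + 1),
        Fin.cons (α := fun _ => ℕ) 0 (fun j : Fin m => e j.succ) j = e j := by
      intro j
      induction j using Fin.cases <;> simp [he0]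
    rw [aeval_radoPolynomial]
    simp only [hd, taylorCoeff_eq]
    -- The limit was taken in the field `ℚ_[p]`; the equation descends along the inclusion of
    -- `ℤ_[p]`.
    apply show Function.Injective (PadicInt.Coe.ringHom (p := p)) from Subtype.coe_injective
    simp only [map_sum, map_mul, map_pow, map_natCast, map_intCast, map_zero]
    exact hroot

end Rado

theorem theorem2p12 {n : ℕ} (P : MvPolynomial (Fin n) ℤ) (hP : Rado.PartitionRegular P) :
    (P ≠ 0 → Rado.MaximalRadoCondition P) ∧
      (Rado.diag P ≠ 0 → (Rado.diag P).Splits → Rado.MinimalRadoCondition P) :=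
  ⟨hP.maximalRadoCondition, hP.minimalRadoCondition⟩
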